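/- A continuum is a nonempty compact connected metric space; a subcontinuum of $X$ is a nonempty compact connected subset of $X$, and $C(X)$ is the set of all subcontinua of $X$ with the Hausdorff metric. A pseudo-arc is a nondegenerate, hereditarily indecomposable, chainable continuum. A subcontinuum $K$ of $X$ is terminal if every subcontinuum $L$ of $X$ that meets $K$ satisfies $K\subset L$ or $L\subset K$. Let $\Psi$ be a circle of pseudo-arcs, that is, a continuum with an open continuous surjection $\Pi:\Psi\to S^1$ all of whose point-inverses are terminal subcontinua of $\Psi$ and pseudo-arcs; put $P_\alpha=\Pi^{-1}(e^{i\alpha})$ for $\alpha\in[0,2\pi)$, so that $\Psi=\bigcup_{\alpha\in[0,2\pi)}P_\alpha$ (the Jones decomposition). Call $K\in C(\Psi)$ filament if there is an open set $U\supset K$ such that the component of $U$ containing $K$ has empty interior, and ample if for every open set $U\supset K$ there is $L\in C(\Psi)$ with $K\subset\operatorname{int}(L)\subset L\subset U$. Let $\mathcal F$ and $\mathcal A$ be the sets of filament and of ample subcontinua of $\Psi$. A minimal ample subcontinuum is an ample subcontinuum that properly contains no ample subcontinuum. Then the Planck boundary $\mathcal A\cap\overline{\mathcal F}$ (closure in $C(\Psi)$)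 is a continuum, and $$\mathcal A\cap\overline{\mathcal F}=\{K\in C(\Psi): K \text{ is a minimal ample subcontinuum of } \Psi\}=\{P_\alpha:\alpha\in[0,2\pi)\}.$$ -/

import Mathlib

open Set Topology TopologicalSpace

namespace PlanckBoundary

/-- A subset of a metric space that is a (sub)continuum: nonempty, compact and connected
(`IsConnected` includes nonemptiness). -/
def IsSubcontinuum {X : Type*} [TopologicalSpace X] (K : Set X) : Prop :=
  IsCompact K ∧ IsConnected K

/-- The hyperspace `C(X)` of all subcontinua of `X`. As a subtype of `NonemptyCompacts X` it
carries the Hausdorff metric and the order by inclusion. -/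
abbrev Hyperspace (X : Type*) [MetricSpace X] : Type _ :=
  {K : NonemptyCompacts X // IsConnected (K : Set X)}

/-- A subcontinuum is decomposable if it is the union of two proper subcontinua. -/
def IsDecomposable {X : Type*} [MetricSpace X] (K : Hyperspace X) : Prop :=
  ∃ A B : Hyperspace X, A ≠ K ∧ B ≠ K ∧ (A.1 : Set X) ∪ (B.1 : Set X) = (K.1 : Set X)

/-- Every subcontinuum is indecomposable. -/
def IsHereditarilyIndecomposable (X : Type*) [MetricSpace X] : Prop :=
  ∀ K : Hyperspace X, ¬ IsDecomposable K

/-- For every `ε > 0` there is a finite open cover `C₁, …, Cₙ` by sets of diameter less than `ε`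
in which two links meet if and only if their indices differ by at most one. -/
def IsChainable (X : Type*) [MetricSpace X] : Prop :=
  ∀ ε : ℝ, 0 < ε → ∃ (n : ℕ) (C : Fin n → Set X),
    (∀ k, IsOpen (C k)) ∧ (⋃ k, C k) = univ ∧ (∀ k, Metric.diam (C k) < ε) ∧
    ∀ k l : Fin n, (C k ∩ C l).Nonempty ↔ |((k : ℕ) : ℤ) - ((l : ℕ) : ℤ)| ≤ 1

/-- A pseudo-arc: a nondegenerate, hereditarily indecomposable, chainable continuum. -/
structure IsPseudoArc (X : Type*) [MetricSpace X] : Prop where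
  compactSpace : CompactSpace X
  connectedSpace : ConnectedSpace X
  nontrivial : Nontrivial X
  hereditarilyIndecomposable : IsHereditarilyIndecomposable X
  chainable : IsChainable X

/-- `K` is a terminal subcontinuum of `X`: every subcontinuum that meets `K` contains `K` or is
contained in `K`. -/
def IsTerminal {X : Type*} [MetricSpace X] (K : Set X) : Prop :=
  IsSubcontinuum K ∧ ∀ L : Set X, IsSubcontinuum L → (K ∩ L).Nonempty → K ⊆ L ∨ L ⊆ K

/-- A map is atomic if all its point-inverses are terminal subcontinua. -/
def IsAtomic {X Y : Type*} [MetricSpace X] (f : X → Y) : Prop :=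
  ∀ y, IsTerminal (f ⁻¹' {y})

/-- A Jones decomposition of `Ψ`, which makes a continuum `Ψ` a circle of pseudo-arcs: an open
atomic map onto the unit circle all of whose point-inverses are pseudo-arcs. -/
structure JonesDecomposition (Ψ : Type*) [MetricSpace Ψ] where
  proj : Ψ → Circle
  continuous_proj : Continuous proj
  surjective_proj : Function.Surjective proj
  isOpenMap_proj : IsOpenMap proj
  isAtomic_proj : IsAtomic proj
  isPseudoArc_fiber : ∀ y : Circle, IsPseudoArc (proj ⁻¹' {y})

/-- The terminal pseudo-arc `P_α = Π⁻¹(e^{iα})` as a point of the hyperspace. -/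
noncomputable def JonesDecomposition.P {Ψ : Type*} [MetricSpace Ψ] (D : JonesDecomposition Ψ)
    (α : ℝ) : Hyperspace Ψ :=
  ⟨⟨⟨D.proj ⁻¹' {Circle.exp α}, (D.isAtomic_proj _).1.1⟩, (D.isAtomic_proj _).1.2.nonempty⟩,
    (D.isAtomic_proj _).1.2⟩

/-- `K` is filament: some open `U ⊇ K` is such that the component of `U` containing `K` has empty
interior (as `K` is connected, that component is the component in `U` of any point of `K`). -/
def IsFilament {X : Type*} [MetricSpace X] (K : Hyperspace X) : Prop :=
  ∃ U : Set X, IsOpen U ∧ (K.1 : Set X) ⊆ U ∧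
    ∀ x ∈ (K.1 : Set X), interior (connectedComponentIn U x) = ∅

/-- `K` is ample: every open `U ⊇ K` contains a subcontinuum with `K` in its interior. -/
def IsAmple {X : Type*} [MetricSpace X] (K : Hyperspace X) : Prop :=
  ∀ U : Set X, IsOpen U → (K.1 : Set X) ⊆ U →
    ∃ L : Hyperspace X, (K.1 : Set X) ⊆ interior (L.1 : Set X) ∧ (L.1 : Set X) ⊆ U

/-- The filament portion of the hyperspace. -/
def filamentPortion (X : Type*) [MetricSpace X] : Set (Hyperspace X) := {K | IsFilament K}

/-- The ample portion of the hyperspace. -/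
def amplePortion (X : Type*) [MetricSpace X] : Set (Hyperspace X) := {K | IsAmple K}

/-- The Planck boundary: the ample portion intersected with the closure, in the hyperspace, of the
filament portion. -/
def planckBoundary (X : Type*) [MetricSpace X] : Set (Hyperspace X) :=
  amplePortion X ∩ closure (filamentPortion X)

/-- `K` is a minimal ample subcontinuum: ample, with no ample proper subcontinuum. -/
def IsMinimalAmple {X : Type*} [MetricSpace X] (K : Hyperspace X) : Prop :=
  IsAmple K ∧ ∀ L : Hyperspace X, IsAmple L → (L.1 : Set X) ⊆ (K.1 : Set X) → L = K

end PlanckBoundary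

/-! Terminality forces every subcontinuum to lie in a fiber of Π or to contain one. Fibers are
ample, since preimages of small arcs are subcontinua (`isAmple_fiber`), while their proper
subcontinua are filament, since fibers are terminal and, Π being open, nowhere dense. As nothing
above an ample continuum is filament, the minimal ample continua are exactly the fibers. Every
filament continuum lies in a fiber, and this condition is closed, so an ample limit of filaments is
a whole fiber. Conversely, indecomposability makes each fiber a limit of its proper subcontinua.
Finally, the fiber map from the circle is continuous because Π is open and closed. -/

namespace PlanckBoundary

/-! ### Filament and ample subcontinua -/

section Hyperspace

variable {X : Type*} [MetricSpace X]

/-- A compact connected set, bundled as a point of the hyperspace. -/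
def IsSubcontinuum.toHyperspace {K : Set X} (hK : IsSubcontinuum K) : Hyperspace X :=
  ⟨⟨⟨K, hK.1⟩, hK.2.nonempty⟩, hK.2⟩

theorem Hyperspace.isSubcontinuum (K : Hyperspace X) : IsSubcontinuum (K.1 : Set X) :=
  ⟨K.1.isCompact, K.2⟩

theorem Hyperspace.ext {K L : Hyperspace X} (h : (K.1 : Set X) = L.1) : K = L :=
  Subtype.ext (NonemptyCompacts.ext h)

/-- A subcontinuum that contains an ample one is not filament. -/
theorem IsAmple.not_isFilament_of_subset {K L : Hyperspace X} (hK : IsAmple K)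
    (hKL : (K.1 : Set X) ⊆ L.1) : ¬ IsFilament L := by
  rintro ⟨U, hU, hLU, h⟩
  obtain ⟨M, hKM, hMU⟩ := hK U hU (hKL.trans hLU)
  obtain ⟨x, hx⟩ := K.1.nonempty
  have hM : (M.1 : Set X) ⊆ connectedComponentIn U x :=
    M.2.isPreconnected.subset_connectedComponentIn (interior_subset (hKM hx)) hMU
  have : x ∈ interior (connectedComponentIn U x) := interior_mono hM (hKM hx)
  rw [h x (hKL hx)] at this
  exact this

/-- A proper subcontinuum of a nowhere dense terminal subcontinuum is filament. -/
theorem IsTerminal.isFilament_of_ssubset [CompactSpace X] {T : Set X} (hT : IsTerminal T)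
    (hint : interior T = ∅) {K : Hyperspace X} (hKT : (K.1 : Set X) ⊆ T)
    (hne : (K.1 : Set X) ≠ T) : IsFilament K := by
  obtain ⟨p, hpT, hpK⟩ := exists_of_ssubset (hKT.ssubset_of_ne hne)
  -- Terminality applies only to closed sets, so `p` must avoid the closure of `U`: then the closed
  -- component cannot contain `T`.
  obtain ⟨U, hU, hKU, hUp⟩ := normal_exists_closure_subset K.1.isCompact.isClosed
    (isOpen_compl_singleton (x := p)) (fun x hx hxp => hpK (hxp ▸ hx))
  refine ⟨U, hU, hKU, fun x hx => ?_⟩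
  have hC : IsSubcontinuum (closure (connectedComponentIn U x)) :=
    ⟨isClosed_closure.isCompact,
      (isConnected_connectedComponentIn_iff.2 (hKU hx)).closure⟩
  have hxC : x ∈ closure (connectedComponentIn U x) :=
    subset_closure (mem_connectedComponentIn (hKU hx))
  rcases hT.2 _ hC ⟨x, hKT hx, hxC⟩ with h | h
  · exact absurd rfl (hUp (closure_mono (connectedComponentIn_subset U x) (h hpT)))
  · exact subset_empty_iff.1 (hint ▸ interior_mono (subset_closure.trans h))

end Hyperspace

/-! ### Boundary bumping and dense proper subcontinua -/

section Indecomposable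

variable {X : Type*}

/-- Boundary bumping: the component of a point in the complement of a nonempty open set reaches
the closure of that set. -/
theorem connectedComponentIn_compl_inter_closure_nonempty [TopologicalSpace X] [T2Space X]
    [CompactSpace X] [ConnectedSpace X] {V : Set X} (hV : IsOpen V) (hVne : V.Nonempty) {q : X}
    (hq : q ∉ V) : (connectedComponentIn Vᶜ q ∩ closure V).Nonempty := by
  by_contra hemp
  have hdisj : ∀ x ∈ connectedComponentIn Vᶜ q, x ∉ closure V := fun x hx hx' => hemp ⟨x, hx, hx'⟩
  have : CompactSpace (Vᶜ : Set X) := isCompact_iff_compactSpace.1 hV.isClosed_compl.isCompact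
  let q' : (Vᶜ : Set X) := ⟨q, hq⟩
  have hO : IsOpen ((↑) ⁻¹' (closure V)ᶜ : Set (Vᶜ : Set X)) :=
    isClosed_closure.isOpen_compl.preimage continuous_subtype_val
  have : Nonempty {s : Set (Vᶜ : Set X) // IsClopen s ∧ q' ∈ s} :=
    ⟨⟨univ, isClopen_univ, mem_univ _⟩⟩
  -- In a compact Hausdorff space components are quasicomponents, so a clopen `Z` around `q'`
  -- already misses `closure V`. It is then clopen in all of `X`.
  obtain ⟨⟨Z, hZ, hqZ⟩, hZO⟩ := exists_subset_nhds_of_compactSpace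
    (V := fun s : {s : Set (Vᶜ : Set X) // IsClopen s ∧ q' ∈ s} => (s : Set (Vᶜ : Set X)))
    (U := (↑) ⁻¹' (closure V)ᶜ)
    (fun s t => ⟨⟨s.1 ∩ t.1, s.2.1.inter t.2.1, s.2.2, t.2.2⟩, inter_subset_left,
      inter_subset_right⟩) (fun s => s.2.1.1) (by
      intro x hx
      rw [← connectedComponent_eq_iInter_isClopen] at hx
      refine hO.mem_nhds (hdisj x ?_)
      rw [connectedComponentIn_eq_image hq]
      exact mem_image_of_mem _ hx)
  have hclosed : IsClosed ((↑) '' Z : Set X) :=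
    hV.isClosed_compl.isClosedEmbedding_subtypeVal.isClosedMap _ hZ.1
  have hopen : IsOpen ((↑) '' Z : Set X) := by
    obtain ⟨W, hW, rfl⟩ := isOpen_induced_iff.1 hZ.2
    have : ((↑) '' ((↑) ⁻¹' W : Set (Vᶜ : Set X)) : Set X) = W ∩ (closure V)ᶜ := by
      ext x
      constructor
      · rintro ⟨y, hy, rfl⟩
        exact ⟨hy, hZO hy⟩
      · rintro ⟨hxW, hx⟩
        exact ⟨⟨x, fun h => hx (subset_closure h)⟩, hxW, rfl⟩
    rw [this]
    exact hW.inter isClosed_closure.isOpen_compl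
  have huniv := IsClopen.eq_univ ⟨hclosed, hopen⟩ ⟨q, q', hqZ, rfl⟩
  obtain ⟨z, hz⟩ := hVne
  obtain ⟨y, -, hy⟩ := huniv.ge (mem_univ z)
  exact y.2 (hy ▸ hz)

variable [MetricSpace X] [CompactSpace X] [ConnectedSpace X] [Nontrivial X]

/-- Every composant of a nondegenerate continuum is dense. -/
theorem exists_proper_subcontinuum_meeting (q : X) {V : Set X} (hV : IsOpen V)
    (hVne : V.Nonempty) :
    ∃ K : Set X, IsSubcontinuum K ∧ K ≠ univ ∧ q ∈ K ∧ (K ∩ V).Nonempty := by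
  by_cases hq : q ∈ V
  · refine ⟨{q}, ⟨isCompact_singleton, isConnected_singleton⟩, fun h => ?_, rfl, q, rfl, hq⟩
    obtain ⟨x, hx⟩ := exists_ne q
    exact hx (h.ge (mem_univ x))
  · obtain ⟨z, hz⟩ := hVne
    -- Bumping only reaches the closure of the removed set, hence the shrinking of `V`.
    obtain ⟨W, hW, hzW, hWV⟩ := normal_exists_closure_subset (isClosed_singleton (x := z)) hV
      (singleton_subset_iff.2 hz)
    have hqW : q ∈ Wᶜ := fun h => hq (hWV (subset_closure h))
    have hclosed : IsClosed (connectedComponentIn Wᶜ q) := by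
      rw [connectedComponentIn_eq_image hqW]
      exact hW.isClosed_compl.isClosedEmbedding_subtypeVal.isClosedMap _ isClosed_connectedComponent
    refine ⟨connectedComponentIn Wᶜ q,
      ⟨hclosed.isCompact,
        isConnected_connectedComponentIn_iff.2 hqW⟩, fun h => ?_,
      mem_connectedComponentIn hqW, ?_⟩
    · exact connectedComponentIn_subset _ _ (h.ge (mem_univ z)) (hzW rfl)
    · exact (connectedComponentIn_compl_inter_closure_nonempty hW ⟨z, hzW rfl⟩ hqW).mono
        (inter_subset_inter_right _ hWV)

/-- A nondegenerate indecomposable continuum has proper subcontinua which are `ε`-dense. -/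
theorem exists_proper_subcontinuum_dense
    (hX : ∀ K : Hyperspace X, (K.1 : Set X) = univ → ¬ IsDecomposable K) {ε : ℝ} (hε : 0 < ε) :
    ∃ K : Set X, IsSubcontinuum K ∧ K ≠ univ ∧ ∀ x, ∃ y ∈ K, dist x y < ε := by
  obtain ⟨q⟩ : Nonempty X := inferInstance
  have key : ∀ t : Set X, t.Finite → ∃ K : Set X, IsSubcontinuum K ∧ K ≠ univ ∧ q ∈ K ∧
      ∀ x ∈ t, (K ∩ Metric.ball x (ε / 2)).Nonempty := by
    intro t ht
    induction t, ht using Set.Finite.induction_on with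
    | empty =>
      obtain ⟨K, hK, hne, hq, -⟩ := exists_proper_subcontinuum_meeting q isOpen_univ univ_nonempty
      exact ⟨K, hK, hne, hq, by simp⟩
    | @insert a s _ _ ih =>
      obtain ⟨K, hK, hKne, hqK, hKs⟩ := ih
      obtain ⟨L, hL, hLne, hqL, hLa⟩ := exists_proper_subcontinuum_meeting q
        (Metric.isOpen_ball (x := a) (ε := ε / 2)) ⟨a, Metric.mem_ball_self (half_pos hε)⟩
      refine ⟨K ∪ L, ⟨hK.1.union hL.1, hK.2.union ⟨q, hqK, hqL⟩ hL.2⟩, fun h => ?_,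
        Or.inl hqK, ?_⟩
      -- Both continua contain `q`, so their union is a continuum; indecomposability keeps it
      -- proper.
      · have hXc : IsSubcontinuum (univ : Set X) := ⟨isCompact_univ, isConnected_univ⟩
        refine hX hXc.toHyperspace rfl ⟨hK.toHyperspace, hL.toHyperspace, fun h' => hKne ?_,
          fun h' => hLne ?_, h⟩
        · exact congrArg (fun M : Hyperspace X => (M.1 : Set X)) h'
        · exact congrArg (fun M : Hyperspace X => (M.1 : Set X)) h'
      · rintro x (rfl | hx)
        · exact hLa.mono (inter_subset_inter_left _ subset_union_right)
        · exact (hKs x hx).mono (inter_subset_inter_left _ subset_union_left)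
  obtain ⟨t, -, ht, hcov⟩ := (isCompact_univ (X := X)).finite_cover_balls (half_pos hε)
  obtain ⟨K, hK, hne, -, hKt⟩ := key t ht
  refine ⟨K, hK, hne, fun x => ?_⟩
  obtain ⟨a, ha, hxa⟩ := mem_iUnion₂.1 (hcov (mem_univ x))
  obtain ⟨y, hy, hya⟩ := hKt a ha
  refine ⟨y, hy, ?_⟩
  rw [Metric.mem_ball] at hxa hya
  linarith [dist_triangle_right x y a]

end Indecomposable

/-! ### Fibers of the Jones decomposition -/

namespace JonesDecomposition

variable {Ψ : Type*} [MetricSpace Ψ] (D : JonesDecomposition Ψ)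

/-- The fiber of the projection as a point of the hyperspace. -/
def fiber (y : Circle) : Hyperspace Ψ := (D.isAtomic_proj y).1.toHyperspace

theorem range_fiber :
    range D.fiber = {K | ∃ α ∈ Ico (0 : ℝ) (2 * Real.pi), K = D.P α} := by
  ext K
  constructor
  · rintro ⟨y, rfl⟩
    obtain ⟨α, rfl⟩ := Circle.exp_surjective y
    obtain ⟨β, hβ, h⟩ := Circle.periodic_exp.exists_mem_Ico₀ Real.two_pi_pos α
    refine ⟨β, hβ, ?_⟩
    rw [h]
    rfl
  · rintro ⟨α, -, rfl⟩
    exact ⟨Circle.exp α, rfl⟩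

theorem interior_fiber (y : Circle) : interior (D.proj ⁻¹' {y}) = ∅ := by
  by_contra h
  obtain ⟨x, hx⟩ := nonempty_iff_ne_empty.2 h
  have himg : D.proj '' interior (D.proj ⁻¹' {y}) = {y} :=
    Subset.antisymm (image_subset_iff.2 interior_subset)
      (singleton_subset_iff.2 ⟨x, hx, interior_subset (s := D.proj ⁻¹' {y}) hx⟩)
  have : Nontrivial Circle := ⟨Circle.exp Real.pi, 1, Circle.exp_pi_ne_one⟩
  exact not_isOpen_singleton y (himg ▸ D.isOpenMap_proj _ isOpen_interior)

theorem exists_subset_or_subset_fiber (K : Hyperspace Ψ) :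
    ∃ y, (K.1 : Set Ψ) ⊆ (D.fiber y).1 ∨ ((D.fiber y).1 : Set Ψ) ⊆ K.1 := by
  obtain ⟨x, hx⟩ := K.1.nonempty
  exact ⟨D.proj x, ((D.isAtomic_proj (D.proj x)).2 _ K.isSubcontinuum ⟨x, rfl, hx⟩).symm⟩

/-- Two points with distinct projections persist, up to small perturbation, in nearby continua. -/
theorem isClosed_setOf_exists_subset_fiber :
    IsClosed {K : Hyperspace Ψ | ∃ y, (K.1 : Set Ψ) ⊆ (D.fiber y).1} := by
  rw [← isOpen_compl_iff, isOpen_iff_mem_nhds]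
  intro K hK
  obtain ⟨a, ha⟩ := K.1.nonempty
  obtain ⟨b, hb, hab⟩ := not_subset.1 fun h => hK ⟨D.proj a, h⟩
  obtain ⟨U, V, hU, hV, hbU, haV, hUV⟩ := t2_separation (show D.proj b ≠ D.proj a from hab)
  have hopen : ∀ {W : Set Circle}, IsOpen W →
      IsOpen {L : Hyperspace Ψ | ((L.1 : Set Ψ) ∩ D.proj ⁻¹' W).Nonempty} := fun hW =>
    (NonemptyCompacts.isOpen_inter_nonempty_of_isOpen (hW.preimage D.continuous_proj)).preimage
      continuous_subtype_val
  filter_upwards [(hopen hU).mem_nhds ⟨b, hb, hbU⟩, (hopen hV).mem_nhds ⟨a, ha, haV⟩]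
  rintro L ⟨u, huL, hu⟩ ⟨v, hvL, hv⟩ ⟨y, hy⟩
  have huv : D.proj u = D.proj v := (hy huL : D.proj u = y).trans (hy hvL : D.proj v = y).symm
  exact disjoint_left.1 hUV hu (huv ▸ hv : D.proj u ∈ V)

variable [CompactSpace Ψ]

theorem isClosedMap_proj : IsClosedMap D.proj := D.continuous_proj.isClosedMap

theorem isAmple_fiber (y : Circle) : IsAmple (D.fiber y) := by
  intro U hU hyU
  obtain ⟨α, rfl⟩ := Circle.exp_surjective y
  have hev : ∀ᶠ z in 𝓝 (Circle.exp α), D.proj ⁻¹' {z} ⊆ U :=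
    D.isClosedMap_proj.eventually_nhds_fiber _ (p := (· ∈ U)) (fun x hx => hU.mem_nhds (hyU hx))
  obtain ⟨r, hr, hball⟩ := Metric.nhds_basis_closedBall.mem_iff.1
    ((Circle.exp.continuous.tendsto α).eventually hev)
  set J : Set Circle := Circle.exp '' Metric.closedBall α r
  have hJ : IsCompact J := (isCompact_closedBall α r).image Circle.exp.continuous
  have hJc : IsConnected J := by
    refine IsConnected.image ?_ _ Circle.exp.continuous.continuousOn
    exact ⟨⟨α, Metric.mem_closedBall_self hr.le⟩, (convex_closedBall α r).isPreconnected⟩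
  have hJn : J ∈ 𝓝 (Circle.exp α) :=
    isLocalHomeomorph_circleExp.isOpenMap.image_mem_nhds (Metric.closedBall_mem_nhds α hr)
  have hquot := D.isOpenMap_proj.isQuotientMap D.continuous_proj D.surjective_proj
  have hL : IsSubcontinuum (D.proj ⁻¹' J) :=
    -- Π is a quotient map with connected fibers, so connectedness of `J` lifts.
    ⟨(hJ.isClosed.preimage D.continuous_proj).isCompact,
      hquot.isCoinducing.isConnected_preimage_of_isClosed
        (fun t => (D.isAtomic_proj t).1.2) hJ.isClosed hJc⟩
  refine ⟨hL.toHyperspace, fun x hx => ?_, ?_⟩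
  · have hx : D.proj x = Circle.exp α := hx
    exact mem_interior_iff_mem_nhds.2 (D.continuous_proj.continuousAt (hx ▸ hJn))
  · rintro x ⟨β, hβ, hx⟩
    exact hball hβ hx.symm

theorem eq_fiber_of_isAmple {K : Hyperspace Ψ} (hK : IsAmple K) {y : Circle}
    (h : (K.1 : Set Ψ) ⊆ (D.fiber y).1) : K = D.fiber y := by
  by_contra hne
  exact hK.not_isFilament_of_subset Subset.rfl
    ((D.isAtomic_proj y).isFilament_of_ssubset (D.interior_fiber y) h
      fun h' => hne (Hyperspace.ext h'))

theorem setOf_isMinimalAmple : {K : Hyperspace Ψ | IsMinimalAmple K} = range D.fiber := by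
  ext K
  constructor
  · rintro ⟨hK, hmin⟩
    obtain ⟨y, h | h⟩ := D.exists_subset_or_subset_fiber K
    · exact ⟨y, (D.eq_fiber_of_isAmple hK h).symm⟩
    · exact ⟨y, hmin _ (D.isAmple_fiber y) h⟩
  · rintro ⟨y, rfl⟩
    exact ⟨D.isAmple_fiber y, fun L hL h => D.eq_fiber_of_isAmple hL h⟩

theorem exists_subset_fiber_of_isFilament {K : Hyperspace Ψ} (hK : IsFilament K) :
    ∃ y, (K.1 : Set Ψ) ⊆ (D.fiber y).1 := by
  obtain ⟨y, h | h⟩ := D.exists_subset_or_subset_fiber K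
  · exact ⟨y, h⟩
  · exact absurd hK ((D.isAmple_fiber y).not_isFilament_of_subset h)

theorem fiber_mem_closure_filamentPortion (y : Circle) :
    D.fiber y ∈ closure (filamentPortion Ψ) := by
  have hP := D.isPseudoArc_fiber y
  have := hP.compactSpace
  have := hP.connectedSpace
  have := hP.nontrivial
  refine Metric.mem_closure_iff.2 fun ε hε => ?_
  obtain ⟨K, hK, hne, hdense⟩ := exists_proper_subcontinuum_dense
    (fun K _ => hP.hereditarilyIndecomposable K) (half_pos hε)
  have hK' : IsSubcontinuum ((↑) '' K : Set Ψ) :=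
    ⟨hK.1.image continuous_subtype_val, hK.2.image _ continuous_subtype_val.continuousOn⟩
  have hsub : ((↑) '' K : Set Ψ) ⊆ D.proj ⁻¹' {y} := by
    rintro _ ⟨x, -, rfl⟩
    exact x.2
  refine ⟨hK'.toHyperspace, (D.isAtomic_proj y).isFilament_of_ssubset (D.interior_fiber y) hsub
    fun h => hne (eq_univ_of_forall fun x => ?_), ?_⟩
  · obtain ⟨z, hz, hzx⟩ := h.ge x.2
    exact Subtype.ext hzx ▸ hz
  · refine lt_of_le_of_lt (Metric.hausdorffDist_le_of_mem_dist (half_pos hε).le ?_ ?_)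
      (half_lt_self hε)
    · intro x hx
      obtain ⟨z, hz, hxz⟩ := hdense ⟨x, hx⟩
      exact ⟨z, mem_image_of_mem _ hz, hxz.le⟩
    · intro x hx
      exact ⟨x, hsub hx, by simpa using (half_pos hε).le⟩

theorem planckBoundary_eq : planckBoundary Ψ = range D.fiber := by
  ext K
  constructor
  · rintro ⟨hK, hcl⟩
    obtain ⟨y, hy⟩ := closure_minimal (fun L hL => D.exists_subset_fiber_of_isFilament hL)
      D.isClosed_setOf_exists_subset_fiber hcl
    exact ⟨y, (D.eq_fiber_of_isAmple hK hy).symm⟩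
  · rintro ⟨y, rfl⟩
    exact ⟨D.isAmple_fiber y, D.fiber_mem_closure_filamentPortion y⟩

theorem continuous_fiber : Continuous D.fiber := by
  let _ : TopologicalSpace (Set Ψ) := TopologicalSpace.vietoris Ψ
  refine Continuous.subtype_mk (NonemptyCompacts.isEmbedding_coe.continuous_iff.2
    (vietoris.continuous_iff.2 ⟨fun U hU => ?_, fun F hF => ?_⟩)) _
  -- Upper semicontinuity comes from Π being closed, lower semicontinuity (next case) from Π being
  -- open.
  · refine isOpen_iff_mem_nhds.2 fun y hy => ?_
    exact D.isClosedMap_proj.eventually_nhds_fiber y (p := (· ∈ U))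
      (fun x hx => hU.mem_nhds (hy hx))
  · rw [← isOpen_compl_iff]
    convert D.isOpenMap_proj _ hF.isOpen_compl using 1
    ext y
    constructor
    · intro h
      obtain ⟨x, hx, hxF⟩ := not_subset.1 h
      exact ⟨x, hxF, hx⟩
    · rintro ⟨x, hxF, rfl⟩ h
      exact hxF (h rfl)

end JonesDecomposition

end PlanckBoundary

theorem mainTheorem4 {Ψ : Type*} [MetricSpace Ψ] [CompactSpace Ψ] [ConnectedSpace Ψ]
    (D : PlanckBoundary.JonesDecomposition Ψ) :
    PlanckBoundary.IsSubcontinuum (PlanckBoundary.planckBoundary Ψ) ∧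
    PlanckBoundary.planckBoundary Ψ =
      {K : PlanckBoundary.Hyperspace Ψ | PlanckBoundary.IsMinimalAmple K} ∧
    {K : PlanckBoundary.Hyperspace Ψ | PlanckBoundary.IsMinimalAmple K} =
      {K : PlanckBoundary.Hyperspace Ψ | ∃ α ∈ Set.Ico (0 : ℝ) (2 * Real.pi), K = D.P α} := by
  rw [D.planckBoundary_eq, D.setOf_isMinimalAmple, D.range_fiber]
  refine ⟨?_, rfl, rfl⟩
  rw [← D.range_fiber]
  exact ⟨isCompact_range D.continuous_fiber, isConnected_range D.continuous_fiber⟩
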